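/- **Conventions.** A semigroup $S$ is inverse if every $s\in S$ has a unique inverse $s^{-1}$ (i.e. $ss^{-1}s=s$, $s^{-1}ss^{-1}=s^{-1}$). $E(S)$ is its set of idempotents, a meet semilattice with $e\le f\iff e=ef$ and $e\wedge f=ef$; the natural order on $S$ is $s\le t\iff s=et$ for some $e\in E(S)$; $S^1$ is $S$ with an identity adjoined. A congruence is idempotent-pure if an element related to an idempotent is idempotent, and $S$ is $E$-disjunctive if its only idempotent-pure congruence is equality. The syntactic congruence $\rho$ relates $s$ and $t$ if, for all $a,b\in S^1$, $asb\in E(S)\iff atb\in E(S)$. Partial functions are written on the right. Given a partial function $\mathcal X\times T\to\mathcal X$, $(x,t)\mapsto (x)t$, $\operatorname{dom} t$ is the set of $x$ with $(x)t$ defined, and the adjoined identity of $T^1$ acts as the identity function. It is an *action* of an inverse semigroup $T$ on the poset $\mathcal X$ if each $t\in T$ acts as an order isomorphism between subsets of $\mathcal X$, $st$ acts as $s$ followed by $t$, and $t^{-1}$ acts as the inverse of $t$. A partial function $q:\mathcal Y\times T\to\mathcal Y$ on a poset $\mathcal Y$ is a *preaction* if for all $s,t\in T^1$, writing $\underline s$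 for the partial function $y\mapsto (y,s)q$: $\underline s$ is an order isomorphism between subsets of $\mathcal Y$; $s\le t$ implies $\underline s\subseteq\underline t$; $(x)\underline s=y$ and $(y)\underline t=z$ imply $(x)\underline{st}=z$; $(x)\underline s=y$ implies $(y)\underline{s^{-1}}=x$; $\operatorname{dom}\underline s$ is an order ideal (down-set); and each $y\in\mathcal Y$ lies in $\operatorname{dom}\underline e$ for some $e\in E(T)$. Let $T$ act on a poset $\mathcal X$, and let $\mathcal Y$ be an order ideal of $\mathcal X$ that is a meet subsemilattice. Write $\operatorname{dom}(t|_{\mathcal Y})=\operatorname{dom}t\cap\mathcal Y$ and, for $y\in\mathcal Y$, $\delta(y)=\bigcap\{\operatorname{dom}(s|_{\mathcal Y}) : s\in T,\ y\in\operatorname{dom}(s|_{\mathcal Y})\}$. Suppose (1) $\operatorname{dom}t$ is an order ideal of $\mathcal X$ for all $t\in T$; (2) for every $y\in\mathcal Y$ there is $t\in T$ with $\operatorname{dom}(t|_{\mathcal Y})=\delta(y)$; (3) for every $x\in\mathcal X$ there is $t\in T$ with $(x)t\in\mathcal Y$. Put $$Q(T,\mathcal Y,\mathcal X)=\{(y,t)\in\mathcal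 Y\times T : \operatorname{dom}(t|_{\mathcal Y})=\delta(y),\ (y)t\in\mathcal Y\},$$ $$(y_1,t_1)(y_2,t_2)=\bigl(((y_1)t_1\wedge y_2)t_1^{-1},\ t_1t_2\bigr).$$ **Theorem.** Let $S$ be an inverse semigroup and $\rho$ its syntactic congruence. Then $\rho$ is the largest idempotent-pure congruence on $S$ and $T=S/\rho$ (called the maximum $E$-disjunctive image of $S$) is $E$-disjunctive. The rule $$(e,t)q=s^{-1}es\quad\text{whenever } s\in S,\ s/\rho\le t \text{ and } e\le ss^{-1}$$ gives a well-defined preaction $q$ of $T$ on $\mathcal Y=E(S)$ (with $(e,t)q$ undefined if there is no such $s$). There are a poset $\mathcal X\supseteq\mathcal Y$, inducing on $\mathcal Y$ the order of $E(S)$, and an action of $T$ on $\mathcal X$ such that * $\mathcal Y$ is an order ideal of $\mathcal X$; for $y,z\in\mathcal Y$ and $t\in T$ one has $(y)t=z$ if and only if $(y,t)q=z$; and for $a,b\in\mathcal X$, $a\le b$ if and only if there is $s\in T^1$ such that $(a)s,(b)s$ are defined, lie in $\mathcal Y$ and satisfy $(a)s\le(b)s$; * $(T,\mathcal Y,\mathcal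 X)$ satisfies all the above requirements for forming $Q(T,\mathcal Y,\mathcal X)$, including (1)–(3), and the set $Q(T,\mathcal Y,\mathcal X)$ is closed under its multiplication; * $s\mapsto(ss^{-1},s/\rho)$ is an isomorphism from $S$ onto $Q(T,\mathcal Y,\mathcal X)$. -/

import Mathlib

universe u v w

/-- An inverse semigroup: every `a` has exactly one `b` with `a b a = a` and `b a b = b`,
and this `b` is `a⁻¹`. -/
class InverseSemigroup (S : Type u) extends Semigroup S, Inv S where
  mul_inv_mul : ∀ a : S, a * a⁻¹ * a = a
  inv_mul_inv : ∀ a : S, a⁻¹ * a * a⁻¹ = a⁻¹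
  inv_unique : ∀ a b : S, a * b * a = a → b * a * b = b → b = a⁻¹

namespace InverseSemigroup

/-! ### Elementary facts needed to form quotients and the semilattice of idempotents -/

section Basic

variable {S : Type u} [InverseSemigroup S]

theorem idem_mul_inv (s : S) : IsIdempotentElem (s * s⁻¹) := by
  unfold IsIdempotentElem
  rw [← mul_assoc, mul_inv_mul]

theorem idem_inv_mul (s : S) : IsIdempotentElem (s⁻¹ * s) := by
  unfold IsIdempotentElem
  rw [← mul_assoc, inv_mul_inv]

theorem idem_inv_eq {e : S} (he : IsIdempotentElem e) : e⁻¹ = e := by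
  have h : e * e = e := he
  exact (inv_unique e e (by rw [h, h]) (by rw [h, h])).symm

theorem idem_mul_idem {e f : S} (he : IsIdempotentElem e) (hf : IsIdempotentElem f) :
    IsIdempotentElem (e * f) := by
  have he' : e * e = e := he
  have hf' : f * f = f := hf
  have h1 := mul_inv_mul (e * f)
  have h2 := inv_mul_inv (e * f)
  generalize hx : (e * f)⁻¹ = x at h1 h2
  have hee : ∀ z, e * (e * z) = e * z := fun z => by rw [← mul_assoc, he']
  have hff : ∀ z, f * (f * z) = f * z := fun z => by rw [← mul_assoc, hf']
  simp only [mul_assoc] at h1 h2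
  have h2' : ∀ z, x * (e * (f * (x * z))) = x * z := fun z => by
    have := congrArg (· * z) h2
    simpa only [mul_assoc] using this
  have hfx : f * (x * e) = x := by
    rw [← hx]
    refine inv_unique (e * f) _ ?_ ?_
    · rw [hx]; simp only [mul_assoc, hee, hff, h1]
    · rw [hx]; simp only [mul_assoc, hee, hff, h2']
  have hxi : IsIdempotentElem x := by
    change x * x = x
    rw [← hfx]
    simp only [mul_assoc, h2']
  have : e * f = x⁻¹ := by
    refine inv_unique x (e * f) ?_ ?_
    · simp only [mul_assoc, h2]
    · simp only [mul_assoc, h1]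
  rw [this, idem_inv_eq hxi]
  exact hxi

theorem idem_comm {e f : S} (he : IsIdempotentElem e) (hf : IsIdempotentElem f) :
    e * f = f * e := by
  have he' : e * e = e := he
  have hf' : f * f = f := hf
  have h1 : e * f * (e * f) = e * f := idem_mul_idem he hf
  have h2 : f * e * (f * e) = f * e := idem_mul_idem hf he
  have hee : ∀ z, e * (e * z) = e * z := fun z => by rw [← mul_assoc, he']
  have hff : ∀ z, f * (f * z) = f * z := fun z => by rw [← mul_assoc, hf']
  simp only [mul_assoc] at h1 h2
  rw [inv_unique (e * f) (f * e) (by simp only [mul_assoc, hee, hff, h1])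
    (by simp only [mul_assoc, hee, hff, h2])]
  exact (idem_inv_eq (idem_mul_idem he hf)).symm

/-- The idempotent `s⁻¹ e s`. -/
theorem idem_conj {e : S} (he : IsIdempotentElem e) (s : S) :
    IsIdempotentElem (s⁻¹ * e * s) := by
  have h : e * (s * s⁻¹) = s * s⁻¹ * e := idem_comm he (idem_mul_inv s)
  have he' : e * e = e := he
  calc s⁻¹ * e * s * (s⁻¹ * e * s) = s⁻¹ * (e * (s * s⁻¹)) * e * s := by
        simp only [mul_assoc]
    _ = s⁻¹ * s * s⁻¹ * (e * e) * s := by rw [h]; simp only [mul_assoc]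
    _ = s⁻¹ * e * s := by rw [inv_mul_inv, he']

end Basic

/-! ### Quotients of inverse semigroups are inverse semigroups -/

section Quotient

variable {S : Type u} [InverseSemigroup S]

/-- An idempotent of a quotient is the class of an idempotent. -/
theorem exists_idem_rep (c : Con S) (x : c.Quotient) (hx : IsIdempotentElem x) :
    ∃ e : S, IsIdempotentElem e ∧ (e : c.Quotient) = x := by
  induction x using Con.induction_on with
  | H a =>
    have hx' : (a : c.Quotient) * a = a := hx
    refine ⟨a * (a * a)⁻¹ * a, ?_, ?_⟩
    · have h := inv_mul_inv (a * a)
      calc a * (a * a)⁻¹ * a * (a * (a * a)⁻¹ * a)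
          = a * ((a * a)⁻¹ * (a * a) * (a * a)⁻¹) * a := by simp only [mul_assoc]
        _ = a * (a * a)⁻¹ * a := by rw [h]
    · have h := congrArg (fun z : S => (z : c.Quotient)) (mul_inv_mul (a * a))
      simpa only [Con.coe_mul, hx'] using h

theorem quotient_inv_unique (c : Con S) (x y z : c.Quotient)
    (h1 : x * y * x = x) (h2 : y * x * y = y) (h3 : x * z * x = x) (h4 : z * x * z = z) :
    y = z := by
  have comm : ∀ p q : c.Quotient, IsIdempotentElem p → IsIdempotentElem q → p * q = q * p := by
    intro p q hp hq
    obtain ⟨e, he, rfl⟩ := exists_idem_rep c p hp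
    obtain ⟨f, hf, rfl⟩ := exists_idem_rep c q hq
    rw [← Con.coe_mul, ← Con.coe_mul, idem_comm he hf]
  have i1 : IsIdempotentElem (y * x) := by
    change y * x * (y * x) = y * x
    rw [← mul_assoc, h2]
  have i2 : IsIdempotentElem (z * x) := by
    change z * x * (z * x) = z * x
    rw [← mul_assoc, h4]
  have i3 : IsIdempotentElem (x * y) := by
    change x * y * (x * y) = x * y
    rw [← mul_assoc, h1]
  have i4 : IsIdempotentElem (x * z) := by
    change x * z * (x * z) = x * z
    rw [← mul_assoc, h3]
  have hy : y = z * x * y := by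
    calc y = y * (x * z * x) * y := by rw [h3, h2]
      _ = (y * x) * (z * x) * y := by simp only [mul_assoc]
      _ = z * (x * y * x) * y := by rw [comm _ _ i1 i2]; simp only [mul_assoc]
      _ = z * x * y := by rw [h1]
  have hz : z = z * x * y := by
    calc z = z * (x * y * x) * z := by rw [h1, h4]
      _ = z * ((x * y) * (x * z)) := by simp only [mul_assoc]
      _ = z * (x * z * x) * y := by rw [comm _ _ i3 i4]; simp only [mul_assoc]
      _ = z * x * y := by rw [h3]
  rw [hy, ← hz]

instance quotientInverseSemigroup (c : Con S) : InverseSemigroup c.Quotient :=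
  { (inferInstance : Semigroup c.Quotient) with
    inv := fun x => Con.liftOn x (fun a : S => ((a⁻¹ : S) : c.Quotient)) (by
      intro a b hab
      have hab' : (a : c.Quotient) = b := (Con.eq c).2 hab
      have l : ∀ d : S, (d : c.Quotient) * ((d⁻¹ : S) : c.Quotient) * d = d := fun d => by
        rw [← Con.coe_mul, ← Con.coe_mul, mul_inv_mul]
      have r : ∀ d : S, ((d⁻¹ : S) : c.Quotient) * d * ((d⁻¹ : S) : c.Quotient)
          = ((d⁻¹ : S) : c.Quotient) := fun d => by
        rw [← Con.coe_mul, ← Con.coe_mul, inv_mul_inv]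
      exact quotient_inv_unique c (a : c.Quotient) _ _ (l a) (r a)
        (by rw [hab']; exact l b) (by rw [hab']; exact r b))
    mul_inv_mul := fun x => by
      induction x using Con.induction_on with
      | H a => exact congrArg (fun z : S => (z : c.Quotient)) (mul_inv_mul a)
    inv_mul_inv := fun x => by
      induction x using Con.induction_on with
      | H a => exact congrArg (fun z : S => (z : c.Quotient)) (inv_mul_inv a)
    inv_unique := fun x y h1 h2 => by
      induction x using Con.induction_on with
      | H a =>
        exact quotient_inv_unique c (a : c.Quotient) _ _ h1 h2
          (congrArg (fun z : S => (z : c.Quotient)) (mul_inv_mul a))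
          (congrArg (fun z : S => (z : c.Quotient)) (inv_mul_inv a)) }

end Quotient

/-! ### The semilattice of idempotents and the natural partial order -/

/-- `E(S)`, the set of idempotents of `S`, as a type. -/
structure Idem (S : Type u) [InverseSemigroup S] where
  val : S
  isIdem : IsIdempotentElem val

/-- `E(S)` is a meet semilattice with `e ≤ f ↔ e = e f` and meet `e f`. -/
instance (S : Type u) [InverseSemigroup S] : SemilatticeInf (Idem S) where
  le e f := e.val = e.val * f.val
  le_refl e := e.isIdem.symm
  le_trans e f g hef hfg := by
    change e.val = e.val * f.val at hef
    change f.val = f.val * g.val at hfg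
    rw [hef, mul_assoc, ← hfg]
  le_antisymm e f hef hfe := by
    change e.val = e.val * f.val at hef
    change f.val = f.val * e.val at hfe
    have : e.val = f.val := by rw [hef, idem_comm e.isIdem f.isIdem, ← hfe]
    cases e; cases f; cases this; rfl
  inf e f := ⟨e.val * f.val, idem_mul_idem e.isIdem f.isIdem⟩
  inf_le_left e f := by
    change e.val * f.val = e.val * f.val * e.val
    rw [mul_assoc, idem_comm f.isIdem e.isIdem, ← mul_assoc, e.isIdem]
  inf_le_right e f := by
    change e.val * f.val = e.val * f.val * f.val
    rw [mul_assoc, f.isIdem]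
  le_inf e f g hef heg := by
    change e.val = e.val * (f.val * g.val)
    change e.val = e.val * f.val at hef
    change e.val = e.val * g.val at heg
    rw [← mul_assoc, ← hef, ← heg]

/-- The idempotent `s s⁻¹`. -/
def rangeIdem {S : Type u} [InverseSemigroup S] (s : S) : Idem S :=
  ⟨s * s⁻¹, idem_mul_inv s⟩

/-- The idempotent `s⁻¹ e s`. -/
def conjIdem {S : Type u} [InverseSemigroup S] (e : Idem S) (s : S) : Idem S :=
  ⟨s⁻¹ * e.val * s, idem_conj e.isIdem s⟩

/-- The natural partial order: `s ≤ t` if and only if `s = e t` for some idempotent `e`.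
It is used for an inverse semigroup `S` and for `S¹ = WithOne S`. -/
def NatLE {S : Type u} [Mul S] (s t : S) : Prop :=
  ∃ e : S, IsIdempotentElem e ∧ s = e * t

/-! ### Idempotent-pure congruences, the syntactic congruence, `E`-disjunctivity -/

def IsIdempotentPure {S : Type u} [InverseSemigroup S] (c : Con S) : Prop :=
  ∀ s e : S, c s e → IsIdempotentElem e → IsIdempotentElem s

/-- `S` is `E`-disjunctive if its only idempotent-pure congruence is equality. -/
def IsEDisjunctive (S : Type u) [InverseSemigroup S] : Prop :=
  ∀ c : Con S, IsIdempotentPure c → ∀ s t : S, c s t → s = t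

/-- The syntactic congruence with respect to `E(S)`: `s` and `t` are related if and only if,
for all `a, b ∈ S¹`, `a s b` is idempotent exactly when `a t b` is. -/
def syntacticCon (S : Type u) [InverseSemigroup S] : Con S where
  r s t := ∀ a b : WithOne S,
    IsIdempotentElem (a * (s : WithOne S) * b) ↔ IsIdempotentElem (a * (t : WithOne S) * b)
  iseqv :=
    { refl := fun _ _ _ => Iff.rfl
      symm := fun h a b => (h a b).symm
      trans := fun h k a b => (h a b).trans (k a b) }
  mul' := by
    intro x x' y y' h k a b
    have h1 := h a ((y : WithOne S) * b)
    have h2 := k (a * (x' : WithOne S)) b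
    simp only [WithOne.coe_mul, mul_assoc] at h1 h2 ⊢
    exact h1.trans h2

/-- `S/ρ`, with `ρ` the syntactic congruence. -/
abbrev SynQuotient (S : Type u) [InverseSemigroup S] : Type u := (syntacticCon S).Quotient

/-! ### Actions and preactions by partial maps

A partial function `α : X × T → X` is written in curried form `α : T → X →. X`, so that `α t` is
the partial function "act by `t` on the right", and `y ∈ α t x` says that `(x, t)` is in the
domain and `(x)t = y`. -/

/-- The extension of `α` to `T¹`, where the adjoined identity acts as the identity function. -/
def actOne {T : Type v} {X : Type w} (α : T → X →. X) : WithOne T → X →. X :=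
  WithOne.recOneCoe (PFun.id X) α

/-- `f` is an order isomorphism between its domain and its image. -/
def IsPartialOrderIso {X : Type w} [PartialOrder X] (f : X →. X) : Prop :=
  ∀ x y x' y' : X, x' ∈ f x → y' ∈ f y → (x ≤ y ↔ x' ≤ y')

/-- An action of an inverse semigroup `T` on a poset `X` by partial order isomorphisms. -/
structure IsAction {T : Type v} [InverseSemigroup T] {X : Type w} [PartialOrder X]
    (α : T → X →. X) : Prop where
  orderIso : ∀ t, IsPartialOrderIso (α t)
  act_mul : ∀ s t, α (s * t) = (α t).comp (α s)
  act_inv : ∀ (t : T) (x y : X), y ∈ α t⁻¹ x ↔ x ∈ α t y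

/-- A preaction of an inverse semigroup `T` on a poset `Y`. -/
structure IsPreaction {T : Type v} [InverseSemigroup T] {Y : Type w} [PartialOrder Y]
    (q : T → Y →. Y) : Prop where
  orderIso : ∀ s : WithOne T, IsPartialOrderIso (actOne q s)
  mono : ∀ s t : WithOne T, NatLE s t → ∀ x y : Y, y ∈ actOne q s x → y ∈ actOne q t x
  act_mul : ∀ (s t : WithOne T) (x y z : Y),
    y ∈ actOne q s x → z ∈ actOne q t y → z ∈ actOne q (s * t) x
  act_inv : ∀ (s : WithOne T) (x y : Y), y ∈ actOne q s x → x ∈ actOne q s⁻¹ y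
  dom_lower : ∀ s : WithOne T, IsLowerSet (actOne q s).Dom
  exists_idem : ∀ y : Y, ∃ e : T, IsIdempotentElem e ∧ y ∈ (q e).Dom

/-- The action `α` of `T` on `X` extends the preaction `q` of `T` on `Y`, where `Y` is regarded as
a subset of `X` through the order embedding `ι`: `Y` is an order ideal of `X`; the restriction of
`α` to those `(y, t)` with `y ∈ Y` and `(y)t ∈ Y` is `q`; and the order of `X` is the one
determined by `Y` and `α`. -/
structure IsActionExtending {T : Type v} [InverseSemigroup T] {X : Type w} [PartialOrder X]
    {Y : Type w} [PartialOrder Y] (α : T → X →. X) (q : T → Y →. Y) (ι : Y ↪o X) : Prop where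
  isAction : IsAction α
  range_lower : IsLowerSet (Set.range ι)
  restrict : ∀ (t : T) (y z : Y), ι z ∈ α t (ι y) ↔ z ∈ q t y
  le_iff : ∀ a b : X, a ≤ b ↔
    ∃ (s : WithOne T) (y z : Y), ι y ∈ actOne α s a ∧ ι z ∈ actOne α s b ∧ ι y ≤ ι z

/-! ### `Q`-semigroups -/

/-- `δ(y) = ⋂ {dom(s|_Y) : s ∈ T, y ∈ dom(s|_Y)}` for `y ∈ Y`, where `dom(s|_Y) = dom(s) ∩ Y`. -/
def delta {T : Type v} {X : Type w} (α : T → X →. X) (Y : Set X) (y : X) : Set X :=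
  ⋂ s ∈ {s : T | y ∈ (α s).Dom ∩ Y}, (α s).Dom ∩ Y

/-- The data `(T, Y, X)` from which a `Q`-semigroup is formed. -/
structure QTriple (T : Type v) [InverseSemigroup T] (X : Type w) [PartialOrder X] where
  act : T → X →. X
  isAction : IsAction act
  Y : Set X
  lower : IsLowerSet Y
  exists_meet : ∀ a ∈ Y, ∀ b ∈ Y, ∃ c ∈ Y, IsGLB {a, b} c
  dom_lower : ∀ t : T, IsLowerSet (act t).Dom
  exists_dom : ∀ y ∈ Y, ∃ t : T, (act t).Dom ∩ Y = delta act Y y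
  exists_mem : ∀ x : X, ∃ t : T, ∃ y ∈ Y, y ∈ act t x

namespace QTriple

variable {T : Type v} [InverseSemigroup T] {X : Type w} [PartialOrder X] (D : QTriple T X)

/-- The set `Q(T, Y, X)` of all `(y, t) ∈ Y × T` with `dom(t|_Y) = δ(y)` and `(y)t ∈ Y`. -/
def carrier : Set (D.Y × T) :=
  {p | (D.act p.2).Dom ∩ D.Y = delta D.act D.Y p.1 ∧ ∃ z ∈ D.Y, z ∈ D.act p.2 p.1}

/-- The meet of two elements of `Y`. -/
noncomputable def meet (a b : D.Y) : D.Y :=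
  ⟨(D.exists_meet a a.2 b b.2).choose, (D.exists_meet a a.2 b b.2).choose_spec.1⟩

theorem meet_isGLB (a b : D.Y) : IsGLB {(a : X), (b : X)} (D.meet a b : X) :=
  (D.exists_meet a a.2 b b.2).choose_spec.2

/-- `(y)t` for `(y, t) ∈ Q(T, Y, X)`. -/
noncomputable def app (p : D.carrier) : D.Y := ⟨p.2.2.choose, p.2.2.choose_spec.1⟩

theorem app_mem (p : D.carrier) : (D.app p : X) ∈ D.act p.1.2 p.1.1 := p.2.2.choose_spec.2

theorem meet_app_mem_dom (p : D.carrier) (b : D.Y) :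
    (D.meet (D.app p) b : X) ∈ (D.act p.1.2⁻¹).Dom := by
  refine D.dom_lower _ ((D.meet_isGLB (D.app p) b).1 (by simp) : _ ≤ (D.app p : X)) ?_
  exact (PFun.mem_dom _ _).2 ⟨_, (D.isAction.act_inv _ _ _).2 (D.app_mem p)⟩

/-- `((y₁)t₁ ∧ b) t₁⁻¹` for `(y₁, t₁) ∈ Q(T, Y, X)` and `b ∈ Y`; it lies in `Y`. -/
noncomputable def pullMeet (p : D.carrier) (b : D.Y) : D.Y :=
  ⟨(D.act p.1.2⁻¹).fn _ (D.meet_app_mem_dom p b), by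
    have h1 : (D.act p.1.2⁻¹).fn _ (D.meet_app_mem_dom p b)
        ∈ D.act p.1.2⁻¹ (D.meet (D.app p) b : X) := Part.get_mem _
    have h2 : (p.1.1 : X) ∈ D.act p.1.2⁻¹ (D.app p : X) :=
      (D.isAction.act_inv _ _ _).2 (D.app_mem p)
    exact D.lower (((D.isAction.orderIso _) _ _ _ _ h1 h2).1
      ((D.meet_isGLB (D.app p) b).1 (by simp))) p.1.1.2⟩

/-- The multiplication `(y₁, t₁)(y₂, t₂) = (((y₁)t₁ ∧ y₂) t₁⁻¹, t₁ t₂)`, with value in `Y × T`. -/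
noncomputable def mul (p r : D.carrier) : D.Y × T :=
  (D.pullMeet p r.1.1, p.1.2 * r.1.2)

/-- `Q(T, Y, X)` is closed under its multiplication. -/
def MulClosed : Prop := ∀ p r : D.carrier, D.mul p r ∈ D.carrier

/-- `Q(T, Y, X)` as a type with multiplication. -/
def Q (_h : D.MulClosed) : Type (max v w) := D.carrier

noncomputable instance (h : D.MulClosed) : Mul (D.Q h) where
  mul p r := ⟨D.mul p r, h p r⟩

end QTriple

end InverseSemigroup

namespace InverseSemigroup

/-! ### Calculus in inverse semigroups: inverses, conjugation, natural order. -/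

section Basic

variable {S : Type u} [InverseSemigroup S]

/-! Maximality of the syntactic congruence is a direct check, and `E`-disjunctivity of `S/ρ` follows
by pulling congruences back to `S`. Everything else works for any idempotent-pure congruence `c`.

The key is `IsIdempotentPure.eq_of_rel`: an element `s` is determined by `s s⁻¹` and its class. In
the form `IsIdempotentPure.eq_mul` it shows that elements whose classes lie below one `t` are
ordered as their idempotents `s s⁻¹` are, so conjugation depends only on `e` and `t` and is a
preaction of `S/c` on `E(S)`.

Any preaction globalizes. Formal points `(y)t`, for `y` fixed by `t t⁻¹`, are identified when the
preaction by `t u⁻¹` takes `y` to `z`, and `T` acts by right multiplication. Two points are compared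
by moving both into `Y`; since domains are down-sets, the element of `T` used does not matter
(`GlobLE.exists_act`).

In this globalization `dom(t|_Y) = δ(e)` means `t t⁻¹ = e/c` (`dom_eq_delta_iff`), and `(e)t ∈ Y`
means that some `s` has `s s⁻¹ = e` and `s/c ≤ t`. Together they force `s/c = t`, so the pairs in
`Q` are exactly the pairs `(s s⁻¹, s/c)`. -/

theorem inv_inv_eq (s : S) : s⁻¹⁻¹ = s :=
  (inv_unique s⁻¹ s (inv_mul_inv s) (mul_inv_mul s)).symm

theorem mul_inv_rev_eq (s t : S) : (s * t)⁻¹ = t⁻¹ * s⁻¹ := by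
  have h : t * t⁻¹ * (s⁻¹ * s) = s⁻¹ * s * (t * t⁻¹) :=
    idem_comm (idem_mul_inv t) (idem_inv_mul s)
  symm
  apply inv_unique
  · calc s * t * (t⁻¹ * s⁻¹) * (s * t) = s * (t * t⁻¹ * (s⁻¹ * s)) * t := by
          simp only [mul_assoc]
      _ = (s * s⁻¹ * s) * (t * t⁻¹ * t) := by rw [h]; simp only [mul_assoc]
      _ = s * t := by rw [mul_inv_mul, mul_inv_mul]
  · calc t⁻¹ * s⁻¹ * (s * t) * (t⁻¹ * s⁻¹) = t⁻¹ * (s⁻¹ * s * (t * t⁻¹)) * s⁻¹ := by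
          simp only [mul_assoc]
      _ = (t⁻¹ * t * t⁻¹) * (s⁻¹ * s * s⁻¹) := by rw [← h]; simp only [mul_assoc]
      _ = t⁻¹ * s⁻¹ := by rw [inv_mul_inv, inv_mul_inv]

theorem idem_conj' {e : S} (he : IsIdempotentElem e) (s : S) :
    IsIdempotentElem (s * e * s⁻¹) := by
  simpa only [inv_inv_eq] using idem_conj he s⁻¹

/-- Conjugation moves an idempotent from the right of `s` to its left, which makes the natural order
two-sided. -/
theorem mul_idem_eq {e : S} (he : IsIdempotentElem e) (s : S) :
    s * e = s * e * s⁻¹ * s := by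
  calc s * e = s * (s⁻¹ * s * e) := by simp only [← mul_assoc, mul_inv_mul]
    _ = s * e * s⁻¹ * s := by rw [idem_comm (idem_inv_mul s) he]; simp only [mul_assoc]

theorem NatLE.refl (s : S) : NatLE s s :=
  ⟨s * s⁻¹, idem_mul_inv s, (mul_inv_mul s).symm⟩

theorem NatLE.trans {r s t : S} (h : NatLE r s) (k : NatLE s t) : NatLE r t := by
  obtain ⟨e, he, rfl⟩ := h
  obtain ⟨f, hf, rfl⟩ := k
  exact ⟨e * f, idem_mul_idem he hf, (mul_assoc _ _ _).symm⟩

theorem idem_mul_natLE {e : S} (he : IsIdempotentElem e) (s : S) : NatLE (e * s) s :=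
  ⟨e, he, rfl⟩

theorem mul_idem_natLE {e : S} (he : IsIdempotentElem e) (s : S) : NatLE (s * e) s :=
  ⟨s * e * s⁻¹, idem_conj' he s, mul_idem_eq he s⟩

theorem NatLE.mul {r s t u : S} (h : NatLE r s) (k : NatLE t u) : NatLE (r * t) (s * u) := by
  obtain ⟨e, he, rfl⟩ := h
  obtain ⟨f, hf, rfl⟩ := k
  refine ⟨e * (s * f * s⁻¹), idem_mul_idem he (idem_conj' hf s), ?_⟩
  have h := mul_idem_eq hf s
  calc e * s * (f * u) = e * (s * f) * u := by simp only [mul_assoc]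
    _ = e * (s * f * s⁻¹) * (s * u) := by rw [h]; simp only [mul_assoc]; simp only [← mul_assoc, mul_inv_mul]

theorem NatLE.inv {s t : S} (h : NatLE s t) : NatLE s⁻¹ t⁻¹ := by
  obtain ⟨e, he, rfl⟩ := h
  rw [mul_inv_rev_eq, idem_inv_eq he]
  exact mul_idem_natLE he _

/-- The unspecified idempotent in the natural order can always be taken to be `s * s⁻¹`. -/
theorem NatLE.eq {s t : S} (h : NatLE s t) : s = s * s⁻¹ * t := by
  obtain ⟨e, he, rfl⟩ := h
  have he' : e * e = e := he
  rw [mul_inv_rev_eq, idem_inv_eq he]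
  calc e * t = e * (t * t⁻¹ * e * t) := by
        rw [idem_comm (idem_mul_inv t) he, mul_assoc e, mul_inv_mul, ← mul_assoc, he']
    _ = e * t * (t⁻¹ * e) * t := by simp only [mul_assoc]

theorem NatLE.antisymm_of_idem {e f : S} (he : IsIdempotentElem e) (hf : IsIdempotentElem f)
    (h : NatLE e f) (k : NatLE f e) : e = f := by
  have h1 := h.eq
  have h2 := k.eq
  rw [idem_inv_eq he, he] at h1
  rw [idem_inv_eq hf, hf] at h2
  rw [h1, idem_comm he hf, ← h2]

theorem NatLE.isIdempotentElem {s e : S} (h : NatLE s e) (he : IsIdempotentElem e) :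
    IsIdempotentElem s := by
  obtain ⟨f, hf, rfl⟩ := h
  exact idem_mul_idem hf he

theorem NatLE.mul_inv_self {s t : S} (h : NatLE s t) : NatLE (s * s⁻¹) (t * t⁻¹) :=
  h.mul h.inv

theorem idem_mul_inv_eq {e : S} (he : IsIdempotentElem e) : e * e⁻¹ = e := by
  rw [idem_inv_eq he, he]

theorem Idem.ext {e f : Idem S} (h : e.val = f.val) : e = f := by
  cases e; cases f; cases h; rfl

theorem Idem.le_iff_natLE {e f : Idem S} : e ≤ f ↔ NatLE e.val f.val :=
  ⟨fun h => ⟨e.val, e.isIdem, h⟩, fun h => by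
    have := h.eq
    rwa [idem_inv_eq e.isIdem, e.isIdem] at this⟩

/-- The product of an idempotent below `s s⁻¹` with `s` has range idempotent that idempotent. -/
theorem idem_mul_mul_inv {e : S} (he : IsIdempotentElem e) {s : S} (h : e = e * (s * s⁻¹)) :
    e * s * (e * s)⁻¹ = e := by
  rw [mul_inv_rev_eq, idem_inv_eq he]
  calc e * s * (s⁻¹ * e) = e * (s * s⁻¹) * e := by simp only [mul_assoc]
    _ = e := by rw [← h, he]

theorem idem_mul_inv_mul {e : S} (he : IsIdempotentElem e) (s : S) :
    (e * s)⁻¹ * (e * s) = s⁻¹ * e * s := by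
  have he' : e * e = e := he
  rw [mul_inv_rev_eq, idem_inv_eq he]
  calc s⁻¹ * e * (e * s) = s⁻¹ * (e * e) * s := by simp only [mul_assoc]
    _ = s⁻¹ * e * s := by rw [he']

end Basic

/-! ### The syntactic congruence -/

section Syntactic

variable {S : Type u} [InverseSemigroup S]

theorem isIdempotentElem_coe {S : Type u} [Semigroup S] (s : S) :
    IsIdempotentElem (s : WithOne S) ↔ IsIdempotentElem s := by
  unfold IsIdempotentElem
  rw [← WithOne.coe_mul, WithOne.coe_inj]

theorem isIdempotentPure_syntacticCon : IsIdempotentPure (syntacticCon S) := by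
  intro s e h he
  have := h 1 1
  simp only [one_mul, mul_one, isIdempotentElem_coe] at this
  exact this.2 he

theorem IsIdempotentPure.le_syntacticCon {c : Con S} (hc : IsIdempotentPure c) :
    c ≤ syntacticCon S := by
  have key : ∀ s t, c s t → (IsIdempotentElem s ↔ IsIdempotentElem t) :=
    fun s t h => ⟨fun hs => hc _ _ (c.symm h) hs, fun ht => hc _ _ h ht⟩
  intro s t h a b
  induction a using WithOne.recOneCoe <;> induction b using WithOne.recOneCoe <;>
    simp only [one_mul, mul_one, ← WithOne.coe_mul, isIdempotentElem_coe] <;> apply key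
  · exact h
  · exact c.mul h (c.refl _)
  · exact c.mul (c.refl _) h
  · exact c.mul (c.mul (c.refl _) h) (c.refl _)

theorem isGreatest_syntacticCon :
    IsGreatest {c : Con S | IsIdempotentPure c} (syntacticCon S) :=
  ⟨isIdempotentPure_syntacticCon, fun _ hc => IsIdempotentPure.le_syntacticCon hc⟩

/-- An idempotent class contains an idempotent, so purity makes all its members idempotent. -/
theorem IsIdempotentPure.isIdempotentElem {c : Con S} (hc : IsIdempotentPure c) {s : S}
    (h : IsIdempotentElem (s : c.Quotient)) : IsIdempotentElem s := by
  obtain ⟨e, he, hes⟩ := exists_idem_rep c _ h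
  exact hc s e ((Con.eq c).1 hes.symm) he

theorem isEDisjunctive_synQuotient : IsEDisjunctive (SynQuotient S) := by
  intro c hc x y hxy
  induction x using Con.induction_on with | H s => ?_
  induction y using Con.induction_on with | H t => ?_
  -- The pullback of `c` to `S` is idempotent-pure because both stages are, so it lies in `ρ`, and
  -- `c` is equality.
  let d : Con S :=
    { r := fun a b => c (a : SynQuotient S) (b : SynQuotient S)
      iseqv := ⟨fun _ => c.refl _, fun h => c.symm h, fun h k => c.trans h k⟩
      mul' := fun h k => c.mul h k }
  have hd : IsIdempotentPure d := fun a e h he =>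
    isIdempotentPure_syntacticCon.isIdempotentElem
      (hc (a : SynQuotient S) (e : SynQuotient S) h (congrArg _ he))
  exact (Con.eq _).2 (hd.le_syntacticCon hxy)

end Syntactic

/-! ### Partial functions from functional relations -/

/-- The partial function whose graph is a functional relation. -/
noncomputable def pfunOfRel {α : Type v} {β : Type w} (r : α → β → Prop) : α →. β :=
  fun a => ⟨∃ b, r a b, fun h => h.choose⟩

theorem mem_pfunOfRel {α : Type v} {β : Type w} {r : α → β → Prop}
    (hr : ∀ a b c, r a b → r a c → b = c) {a : α} {b : β} : b ∈ pfunOfRel r a ↔ r a b :=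
  ⟨fun ⟨h, hb⟩ => hb ▸ h.choose_spec, fun h => ⟨⟨b, h⟩, hr _ _ _ (Exists.choose_spec _) h⟩⟩

/-! ### Preactions -/

section Preaction

variable {T : Type v} [InverseSemigroup T] {Y : Type w} [PartialOrder Y] {q : T → Y →. Y}

/-- Reduces the axioms over `T¹` to `T`. Elements of `T` below the adjoined identity are
idempotents, hence the hypothesis `idem`; order reflection is order preservation for the inverse. -/
theorem IsPreaction.of_coe
    (orderIso : ∀ (t : T) (x y x' y' : Y), x' ∈ q t x → y' ∈ q t y → x ≤ y → x' ≤ y')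
    (mono : ∀ s t : T, NatLE s t → ∀ x y : Y, y ∈ q s x → y ∈ q t x)
    (idem : ∀ e : T, IsIdempotentElem e → ∀ x y : Y, y ∈ q e x → y = x)
    (act_mul : ∀ (s t : T) (x y z : Y), y ∈ q s x → z ∈ q t y → z ∈ q (s * t) x)
    (act_inv : ∀ (s : T) (x y : Y), y ∈ q s x → x ∈ q s⁻¹ y)
    (dom_lower : ∀ s : T, IsLowerSet (q s).Dom)
    (exists_idem : ∀ y : Y, ∃ e : T, IsIdempotentElem e ∧ y ∈ (q e).Dom) : IsPreaction q where
  orderIso s := by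
    induction s using WithOne.recOneCoe with
    | one =>
      intro x y x' y' hx hy
      rw [Part.mem_some_iff.1 hx, Part.mem_some_iff.1 hy]
    | coe s =>
      exact fun x y x' y' hx hy => ⟨orderIso s x y x' y' hx hy,
        orderIso s⁻¹ x' y' x y (act_inv _ _ _ hx) (act_inv _ _ _ hy)⟩
  mono := by
    rintro s t ⟨e, he, rfl⟩ x y
    induction e using WithOne.recOneCoe with
    | one => rw [one_mul]; exact id
    | coe e =>
      rw [isIdempotentElem_coe] at he
      induction t using WithOne.recOneCoe with
      | one => exact fun h => Part.mem_some_iff.2 (idem e he x y h)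
      | coe t => exact mono (e * t) t ⟨e, he, rfl⟩ x y
  act_mul s t x y z hy hz := by
    induction s using WithOne.recOneCoe with
    | one =>
      rw [one_mul, ← Part.mem_some_iff.1 hy]; exact hz
    | coe s =>
      induction t using WithOne.recOneCoe with
      | one => rw [mul_one, Part.mem_some_iff.1 hz]; exact hy
      | coe t => exact act_mul s t x y z hy hz
  act_inv s x y h := by
    induction s using WithOne.recOneCoe with
    | one => exact Part.mem_some_iff.2 (Part.mem_some_iff.1 h).symm
    | coe s => exact act_inv s x y h
  dom_lower s := by
    induction s using WithOne.recOneCoe with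
    | one => exact fun _ _ _ _ => trivial
    | coe s => exact dom_lower s
  exists_idem := exists_idem

end Preaction

/-! ### The preaction of `S/c` on `E(S)` for an idempotent-pure congruence `c` -/

section QuotientPreaction

variable {S : Type u} [InverseSemigroup S] {c : Con S}

/-- The element `f = t⁻¹ s` is related to `s⁻¹ s`, hence idempotent and equal to its inverse `s⁻¹
t`. Then `s = t f` and `t = s f`, so `s = s f f = s f = t`. -/
theorem IsIdempotentPure.eq_of_rel (hc : IsIdempotentPure c) {s t : S} (h : c s t)
    (hst : s * s⁻¹ = t * t⁻¹) : s = t := by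
  have hf : IsIdempotentElem (t⁻¹ * s) := by
    refine hc _ (s⁻¹ * s) ?_ (idem_inv_mul s)
    refine c.mul ((Con.eq c).1 ?_) (c.refl s)
    exact congrArg (·⁻¹) ((Con.eq c).2 h).symm
  have hinv : t⁻¹ * s = s⁻¹ * t := by
    conv_lhs => rw [← idem_inv_eq hf, mul_inv_rev_eq, inv_inv_eq]
  have h1 : s = t * (t⁻¹ * s) := by rw [← mul_assoc, ← hst, mul_inv_mul]
  have h2 : t = s * (t⁻¹ * s) := by rw [hinv, ← mul_assoc, hst, mul_inv_mul]
  calc s = t * (t⁻¹ * s) := h1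
    _ = s * (t⁻¹ * s) * (t⁻¹ * s) := by rw [← h2]
    _ = s * (t⁻¹ * s) := by rw [mul_assoc, hf]
    _ = t := h2.symm

theorem NatLE.coe {s t : S} (h : NatLE s t) : NatLE (s : c.Quotient) (t : c.Quotient) := by
  obtain ⟨e, he, rfl⟩ := h
  exact ⟨e, congrArg _ he, rfl⟩

theorem isIdempotentElem_coe_quotient {e : S} (he : IsIdempotentElem e) :
    IsIdempotentElem (e : c.Quotient) := congrArg (fun z : S => (z : c.Quotient)) he

/-- If `s/c` and `t/c` have a common upper bound and `s s⁻¹ ≤ t t⁻¹` then `s ≤ t`. -/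
theorem IsIdempotentPure.eq_mul (hc : IsIdempotentPure c) {s t : S} {x : c.Quotient}
    (hs : NatLE (s : c.Quotient) x) (ht : NatLE (t : c.Quotient) x)
    (h : s * s⁻¹ = s * s⁻¹ * (t * t⁻¹)) : s = s * s⁻¹ * t := by
  -- Both `s` and `s s⁻¹ t` have class below `x` and the same range idempotent, so their classes are
  -- the same restriction of `x`.
  have h1 : s * s⁻¹ * t * (s * s⁻¹ * t)⁻¹ = s * s⁻¹ := idem_mul_mul_inv (idem_mul_inv s) h
  refine hc.eq_of_rel ((Con.eq c).1 ?_) h1.symm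
  have h2 : NatLE ((s * s⁻¹ * t : S) : c.Quotient) x :=
    (idem_mul_natLE (idem_mul_inv s) t).coe.trans ht
  rw [hs.eq, h2.eq]
  exact congrArg (fun z : S => (z : c.Quotient) * x) h1.symm

/-- The graph of the partial map `e ↦ s⁻¹ e s` for `s/c ≤ t` and `e ≤ s s⁻¹`. -/
def ConjRel (c : Con S) (t : c.Quotient) (e f : Idem S) : Prop :=
  ∃ s : S, NatLE (s : c.Quotient) t ∧ e ≤ rangeIdem s ∧ f = conjIdem e s

/-- Replacing `s` by `e s` turns `e ≤ s s⁻¹` into an equality; the map then sends `s s⁻¹` to `s⁻¹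
s`. -/
theorem conjRel_iff {t : c.Quotient} {e f : Idem S} : ConjRel c t e f ↔
    ∃ s : S, NatLE (s : c.Quotient) t ∧ s * s⁻¹ = e.val ∧ s⁻¹ * s = f.val := by
  constructor
  · rintro ⟨s, hs, he, rfl⟩
    exact ⟨e.val * s, (idem_mul_natLE e.isIdem s).coe.trans hs,
      idem_mul_mul_inv e.isIdem he, idem_mul_inv_mul e.isIdem s⟩
  · rintro ⟨s, hs, he, hf⟩
    refine ⟨s, hs, Eq.le (Idem.ext he.symm), Idem.ext ?_⟩
    change f.val = s⁻¹ * e.val * s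
    rw [← he, ← mul_assoc, inv_mul_inv, hf]

theorem IsIdempotentPure.conjRel_unique (hc : IsIdempotentPure c) (t : c.Quotient)
    (e f g : Idem S) (hf : ConjRel c t e f) (hg : ConjRel c t e g) : f = g := by
  obtain ⟨s, hs, hse, hsf⟩ := conjRel_iff.1 hf
  obtain ⟨r, hr, hre, hrg⟩ := conjRel_iff.1 hg
  have : s = r := by
    rw [hc.eq_mul hs hr (by rw [hse, hre, e.isIdem]), hse, ← hre, mul_inv_mul]
  subst this
  exact Idem.ext (hsf.symm.trans hrg)

/-- The partial map `e ↦ s⁻¹ e s` for `s/c ≤ t` and `e ≤ s s⁻¹`. -/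
noncomputable def conjPFun (c : Con S) (t : c.Quotient) : Idem S →. Idem S :=
  pfunOfRel (ConjRel c t)

theorem IsIdempotentPure.mem_conjPFun (hc : IsIdempotentPure c) {t : c.Quotient}
    {e f : Idem S} : f ∈ conjPFun c t e ↔ ConjRel c t e f :=
  mem_pfunOfRel (hc.conjRel_unique t)

theorem IsIdempotentPure.mem_conjPFun' (hc : IsIdempotentPure c) {t : c.Quotient}
    {e f : Idem S} : f ∈ conjPFun c t e ↔
    ∃ s : S, NatLE (s : c.Quotient) t ∧ s * s⁻¹ = e.val ∧ s⁻¹ * s = f.val :=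
  hc.mem_conjPFun.trans conjRel_iff

theorem IsIdempotentPure.isPreaction (hc : IsIdempotentPure c) :
    IsPreaction (conjPFun c) := by
  apply IsPreaction.of_coe
  · intro t x y x' y' hx hy hxy
    obtain ⟨s, hs, hsx, hsx'⟩ := hc.mem_conjPFun'.1 hx
    obtain ⟨r, hr, hry, hry'⟩ := hc.mem_conjPFun'.1 hy
    have h : NatLE s r :=
      ⟨_, idem_mul_inv s, hc.eq_mul hs hr (by rw [hsx, hry]; exact hxy)⟩
    rw [Idem.le_iff_natLE, ← hsx', ← hry']
    exact h.inv.mul h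
  · intro s t hst x y h
    obtain ⟨r, hr, h⟩ := hc.mem_conjPFun'.1 h
    exact hc.mem_conjPFun'.2 ⟨r, hr.trans hst, h⟩
  · intro e he x y h
    obtain ⟨r, hr, hx, hy⟩ := hc.mem_conjPFun'.1 h
    -- The class of `r` is below an idempotent, hence idempotent; purity lifts this to `r`.
    have hr' := hc.isIdempotentElem (hr.isIdempotentElem he)
    rw [idem_inv_eq hr'] at hx hy
    exact Idem.ext (hy.symm.trans hx)
  · intro s t x y z hy hz
    obtain ⟨a, ha, hax, hay⟩ := hc.mem_conjPFun'.1 hy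
    obtain ⟨b, hb, hby, hbz⟩ := hc.mem_conjPFun'.1 hz
    refine hc.mem_conjPFun'.2 ⟨a * b, ha.mul hb, ?_, ?_⟩
    · rw [mul_inv_rev_eq, ← hax]
      calc a * b * (b⁻¹ * a⁻¹) = a * (b * b⁻¹) * a⁻¹ := by simp only [mul_assoc]
        _ = a * a⁻¹ := by rw [hby, ← hay, ← mul_assoc, mul_inv_mul]
    · rw [mul_inv_rev_eq, ← hbz]
      calc b⁻¹ * a⁻¹ * (a * b) = b⁻¹ * (a⁻¹ * a) * b := by simp only [mul_assoc]
        _ = b⁻¹ * b := by rw [hay, ← hby, ← mul_assoc, inv_mul_inv]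
  · intro s x y h
    obtain ⟨a, ha, hax, hay⟩ := hc.mem_conjPFun'.1 h
    exact hc.mem_conjPFun'.2 ⟨a⁻¹, ha.inv, by rwa [inv_inv_eq], by rwa [inv_inv_eq]⟩
  · rintro s x y hyx ⟨z, r, hr, hxr, -⟩
    exact ⟨_, r, hr, hyx.trans hxr, rfl⟩
  · intro e
    refine ⟨(e.val : c.Quotient), isIdempotentElem_coe_quotient e.isIdem, ?_⟩
    refine (PFun.mem_dom _ _).2 ⟨e, hc.mem_conjPFun'.2 ⟨e.val, NatLE.refl _, ?_, ?_⟩⟩ <;>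
      rw [idem_inv_eq e.isIdem, e.isIdem]

end QuotientPreaction

/-! ### The globalization of a preaction -/

namespace IsPreaction

variable {T : Type v} [InverseSemigroup T] {Y : Type w} [PartialOrder Y] {q : T → Y →. Y}

theorem mem_mul (hq : IsPreaction q) {s t : T} {x y z : Y} (h : y ∈ q s x) (k : z ∈ q t y) :
    z ∈ q (s * t) x := hq.act_mul s t x y z h k

theorem mem_inv (hq : IsPreaction q) {s : T} {x y : Y} (h : y ∈ q s x) : x ∈ q s⁻¹ y :=
  hq.act_inv s x y h

theorem mem_mono (hq : IsPreaction q) {s t : T} (hst : NatLE s t) {x y : Y} (h : y ∈ q s x) :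
    y ∈ q t x := by
  obtain ⟨e, he, rfl⟩ := hst
  exact hq.mono (e * t : T) t ⟨e, (isIdempotentElem_coe e).2 he, rfl⟩ x y h

theorem eq_of_idem (hq : IsPreaction q) {e : T} (he : IsIdempotentElem e) {x y : Y}
    (h : y ∈ q e x) : y = x :=
  Part.mem_some_iff.1 (hq.mono e 1 ⟨e, (isIdempotentElem_coe e).2 he, (mul_one _).symm⟩ x y h)

theorem le_of_mem (hq : IsPreaction q) {s : T} {x y x' y' : Y} (hx : x' ∈ q s x)
    (hy : y' ∈ q s y) (h : x ≤ y) : x' ≤ y' :=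
  (hq.orderIso s x y x' y' hx hy).1 h

theorem exists_mem_of_le (hq : IsPreaction q) {s : T} {x y y' : Y} (hy : y' ∈ q s y)
    (h : x ≤ y) : ∃ x', x' ∈ q s x :=
  (PFun.mem_dom _ _).1 (hq.dom_lower s h ((PFun.mem_dom _ _).2 ⟨y', hy⟩))

theorem mem_idem_of_le (hq : IsPreaction q) {e : T} (he : IsIdempotentElem e) {x y : Y}
    (hy : y ∈ q e y) (h : x ≤ y) : x ∈ q e x := by
  obtain ⟨x', hx'⟩ := hq.exists_mem_of_le hy h
  rwa [hq.eq_of_idem he hx'] at hx'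

theorem mem_mul_inv (hq : IsPreaction q) {s : T} {x y : Y} (h : y ∈ q s x) :
    x ∈ q (s * s⁻¹) x := hq.mem_mul h (hq.mem_inv h)

theorem exists_idem_mem (hq : IsPreaction q) (y : Y) :
    ∃ e : T, IsIdempotentElem e ∧ y ∈ q e y := by
  obtain ⟨e, he, h⟩ := hq.exists_idem y
  obtain ⟨z, hz⟩ := (PFun.mem_dom _ _).1 h
  exact ⟨e, he, hq.eq_of_idem he hz ▸ hz⟩

/-- Transitivity of the gluing relation, from `s t⁻¹ t u⁻¹ ≤ s u⁻¹`. -/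
theorem mem_mul_inv_mul (hq : IsPreaction q) {s t u : T} {x y z : Y} (h : y ∈ q (s * t⁻¹) x)
    (k : z ∈ q (t * u⁻¹) y) : z ∈ q (s * u⁻¹) x := by
  refine hq.mem_mono ?_ (hq.mem_mul h k)
  have : s * t⁻¹ * (t * u⁻¹) = s * (t⁻¹ * t) * u⁻¹ := by simp only [mul_assoc]
  rw [this]
  exact (mul_idem_natLE (idem_inv_mul t) s).mul (NatLE.refl _)

theorem mem_mul_inv_symm (hq : IsPreaction q) {s t : T} {x y : Y} (h : y ∈ q (s * t⁻¹) x) :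
    x ∈ q (t * s⁻¹) y := by
  have := hq.mem_inv h
  rwa [mul_inv_rev_eq, inv_inv_eq] at this

/-- The pairs `(y, t)` such that `t t⁻¹` fixes `y`, identified if they are to represent the same
point `(y)t` of the globalization. -/
def setoid (hq : IsPreaction q) : Setoid {p : Y × T // p.1 ∈ q (p.2 * p.2⁻¹) p.1} where
  r a b := b.1.1 ∈ q (a.1.2 * b.1.2⁻¹) a.1.1
  iseqv := ⟨fun a => a.2, fun h => hq.mem_mul_inv_symm h, fun h k => hq.mem_mul_inv_mul h k⟩

/-- The globalization of a preaction. -/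
def Glob (hq : IsPreaction q) : Type (max v w) := Quotient hq.setoid

variable (hq : IsPreaction q)

/-- The point `(y)t` of the globalization. -/
def globMk (y : Y) (t : T) (h : y ∈ q (t * t⁻¹) y) : hq.Glob := Quotient.mk hq.setoid ⟨(y, t), h⟩

theorem globMk_eq_globMk {y z : Y} {t u : T} {hy : y ∈ q (t * t⁻¹) y} {hz : z ∈ q (u * u⁻¹) z} :
    hq.globMk y t hy = hq.globMk z u hz ↔ z ∈ q (t * u⁻¹) y :=
  Quotient.eq (r := hq.setoid)

theorem exists_globMk (a : hq.Glob) : ∃ y t h, a = hq.globMk y t h := by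
  induction a using Quotient.inductionOn with
  | h p => exact ⟨p.1.1, p.1.2, p.2, rfl⟩

/-- The graph of the action by `t` on the globalization. -/
def Act (t : T) (a b : hq.Glob) : Prop :=
  ∃ y u h h', a = hq.globMk y u h ∧ b = hq.globMk y (u * t) h'

theorem act_globMk {t u : T} {y : Y} {h : y ∈ q (u * u⁻¹) y} {b : hq.Glob} :
    hq.Act t (hq.globMk y u h) b ↔ ∃ h', b = hq.globMk y (u * t) h' := by
  refine ⟨?_, fun ⟨h', hb⟩ => ⟨y, u, h, h', rfl, hb⟩⟩
  rintro ⟨z, v, hv, hv', huv, rfl⟩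
  have h1 := hq.globMk_eq_globMk.1 huv
  -- Independence of the representative: fixing `z` by `v t (v t)⁻¹` and then moving it to `y` by `v
  -- u⁻¹` is a restriction of `v t (u t)⁻¹`.
  have h2 : y ∈ q (v * t * (u * t)⁻¹) z := by
    refine hq.mem_mono ?_ (hq.mem_mul hv' (hq.mem_mul_inv_symm h1))
    have e1 : v * t * (v * t)⁻¹ * (v * u⁻¹) = v * t * t⁻¹ * (v⁻¹ * v) * u⁻¹ := by
      rw [mul_inv_rev_eq]; simp only [mul_assoc]
    have e2 : v * t * (u * t)⁻¹ = v * t * t⁻¹ * u⁻¹ := by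
      rw [mul_inv_rev_eq]; simp only [mul_assoc]
    rw [e1, e2]
    exact (mul_idem_natLE (idem_inv_mul v) _).mul (NatLE.refl _)
  have h3 := hq.mem_mul_inv_mul (hq.mem_mul_inv_symm h2) h2
  exact ⟨h3, hq.globMk_eq_globMk.2 h2⟩

theorem act_unique (t : T) (a b c : hq.Glob) (hb : hq.Act t a b) (hc : hq.Act t a c) :
    b = c := by
  obtain ⟨y, u, h, rfl⟩ := hq.exists_globMk a
  obtain ⟨_, rfl⟩ := hq.act_globMk.1 hb
  obtain ⟨_, rfl⟩ := hq.act_globMk.1 hc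
  rfl

/-- Since `(u s t)(u s t)⁻¹ ≤ (u s)(u s)⁻¹`, the intermediate point exists whenever the product
acts. This upgrades the preaction to an action. -/
theorem act_mul_iff {s t : T} {a c : hq.Glob} :
    hq.Act (s * t) a c ↔ ∃ b, hq.Act s a b ∧ hq.Act t b c := by
  obtain ⟨y, u, h, rfl⟩ := hq.exists_globMk a
  constructor
  · intro hc
    obtain ⟨h', rfl⟩ := hq.act_globMk.1 hc
    have h1 : y ∈ q (u * s * (u * s)⁻¹) y := by
      refine hq.mem_mono ?_ h'
      have : u * (s * t) * (u * (s * t))⁻¹ = u * s * (t * t⁻¹) * (u * s)⁻¹ := by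
        rw [← mul_assoc u, mul_inv_rev_eq]; simp only [mul_assoc]
      rw [this]
      exact (mul_idem_natLE (idem_mul_inv t) _).mul (NatLE.refl _)
    refine ⟨hq.globMk y (u * s) h1, hq.act_globMk.2 ⟨h1, rfl⟩, hq.act_globMk.2 ⟨?_, ?_⟩⟩
    · rwa [mul_assoc u s t]
    · simp only [mul_assoc]
  · rintro ⟨b, hb, hc⟩
    obtain ⟨h1, rfl⟩ := hq.act_globMk.1 hb
    obtain ⟨h2, rfl⟩ := hq.act_globMk.1 hc
    refine hq.act_globMk.2 ⟨?_, ?_⟩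
    · rwa [← mul_assoc u s t]
    · simp only [mul_assoc]

theorem act_symm {t : T} {a b : hq.Glob} (hab : hq.Act t a b) : hq.Act t⁻¹ b a := by
  obtain ⟨y, u, h, rfl⟩ := hq.exists_globMk a
  obtain ⟨h', rfl⟩ := hq.act_globMk.1 hab
  have e : u * t * t⁻¹ * (u * t * t⁻¹)⁻¹ = u * t * (u * t)⁻¹ := by
    calc u * t * t⁻¹ * (u * t * t⁻¹)⁻¹ = u * (t * t⁻¹ * t) * (t⁻¹ * u⁻¹) := by
          simp only [mul_inv_rev_eq, inv_inv_eq, mul_assoc]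
      _ = u * t * (u * t)⁻¹ := by rw [mul_inv_mul, mul_inv_rev_eq]
  refine hq.act_globMk.2 ⟨e ▸ h', hq.globMk_eq_globMk.2 ?_⟩
  have e2 : u * (u * t * t⁻¹)⁻¹ = u * t * (u * t)⁻¹ := by
    simp only [mul_inv_rev_eq, inv_inv_eq, mul_assoc]
  rwa [e2]

theorem act_inv_iff {t : T} {a b : hq.Glob} : hq.Act t⁻¹ a b ↔ hq.Act t b a :=
  ⟨fun h => inv_inv_eq t ▸ hq.act_symm h, hq.act_symm⟩

theorem act_inj {t : T} {a b c : hq.Glob} (ha : hq.Act t a c) (hb : hq.Act t b c) : a = b :=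
  hq.act_unique t⁻¹ c a b (hq.act_symm ha) (hq.act_symm hb)

/-- The embedding of a preaction into its globalization. -/
noncomputable def toGlob (y : Y) : hq.Glob :=
  hq.globMk y (hq.exists_idem_mem y).choose <| by
    obtain ⟨he, h⟩ := (hq.exists_idem_mem y).choose_spec
    rwa [idem_mul_inv_eq he]

/-- Shows that the idempotent chosen in `toGlob` is immaterial, and that a point `(y)t` falls in `Y`
only where the preaction already puts it. -/
theorem globMk_eq_toGlob {t : T} {y z : Y} {h : y ∈ q (t * t⁻¹) y} :
    hq.globMk y t h = hq.toGlob z ↔ z ∈ q t y := by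
  obtain ⟨he, hz⟩ := (hq.exists_idem_mem z).choose_spec
  unfold toGlob
  rw [globMk_eq_globMk, idem_inv_eq he]
  exact ⟨hq.mem_mono (mul_idem_natLE he t), fun h => hq.mem_mul h hz⟩

theorem exists_toGlob (y : Y) : ∃ (e : T) (_ : IsIdempotentElem e) (h : y ∈ q e y),
    hq.toGlob y = hq.globMk y e ((idem_mul_inv_eq ‹_›).symm ▸ h) :=
  ⟨_, (hq.exists_idem_mem y).choose_spec.1, (hq.exists_idem_mem y).choose_spec.2, rfl⟩

theorem act_toGlob {t : T} {y : Y} {b : hq.Glob} :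
    hq.Act t (hq.toGlob y) b ↔ ∃ h, b = hq.globMk y t h := by
  obtain ⟨e, he, h, hy⟩ := hq.exists_toGlob y
  have e1 : e * t * (e * t)⁻¹ = e * (t * t⁻¹) * e := by
    rw [mul_inv_rev_eq, idem_inv_eq he]; simp only [mul_assoc]
  have e2 : e * t * t⁻¹ = e * (t * t⁻¹) := by simp only [mul_assoc]
  rw [hy, act_globMk]
  constructor
  · rintro ⟨h', rfl⟩
    have h1 := hq.mem_mono (((idem_mul_natLE he _).mul (NatLE.refl e)).trans
      (mul_idem_natLE he _)) (e1 ▸ h')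
    refine ⟨h1, hq.globMk_eq_globMk.2 ?_⟩
    rw [e2]
    exact hq.mem_mul h h1
  · rintro ⟨h1, rfl⟩
    refine ⟨e1.symm ▸ hq.mem_mul (hq.mem_mul h h1) h, ?_⟩
    symm
    rw [globMk_eq_globMk, e2]
    exact hq.mem_mul h h1

theorem act_toGlob_toGlob {t : T} {y z : Y} :
    hq.Act t (hq.toGlob y) (hq.toGlob z) ↔ z ∈ q t y := by
  rw [act_toGlob]
  exact ⟨fun ⟨_, h⟩ => hq.globMk_eq_toGlob.1 h.symm,
    fun h => ⟨hq.mem_mul_inv h, (hq.globMk_eq_toGlob.2 h).symm⟩⟩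

/-- In the globalization `t` is defined at `y` even when `(y)t` falls outside `Y`. -/
theorem exists_act_toGlob {t : T} {y : Y} :
    (∃ b, hq.Act t (hq.toGlob y) b) ↔ y ∈ q (t * t⁻¹) y :=
  ⟨fun ⟨_, h⟩ => (hq.act_toGlob.1 h).1, fun h => ⟨hq.globMk y t h, hq.act_toGlob.2 ⟨h, rfl⟩⟩⟩

theorem exists_act_eq_toGlob (a : hq.Glob) : ∃ t y, hq.Act t a (hq.toGlob y) := by
  obtain ⟨y, t, h, rfl⟩ := hq.exists_globMk a
  exact ⟨t⁻¹, y, hq.act_symm (hq.act_toGlob.2 ⟨h, rfl⟩)⟩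

theorem toGlob_injective : Function.Injective hq.toGlob := by
  intro y z h
  obtain ⟨e, he, hy⟩ := hq.exists_idem_mem y
  have := hq.act_toGlob_toGlob.2 hy
  nth_rw 2 [h] at this
  exact (hq.eq_of_idem he (hq.act_toGlob_toGlob.1 this)).symm

/-- The order of the globalization. -/
def GlobLE (a b : hq.Glob) : Prop :=
  ∃ t y z, hq.Act t a (hq.toGlob y) ∧ hq.Act t b (hq.toGlob z) ∧ y ≤ z

/-- If `a ≤ b` and `b` is sent to `z ∈ Y` by `s`, then `s` sends `a` to some `y ≤ z`. -/
theorem GlobLE.exists_act {a b : hq.Glob} (h : hq.GlobLE a b) {s : T} {z : Y}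
    (hb : hq.Act s b (hq.toGlob z)) : ∃ y, hq.Act s a (hq.toGlob y) ∧ y ≤ z := by
  obtain ⟨t, y', z', hy', hz', hle⟩ := h
  -- Going through `b`, the element `t⁻¹ s` moves `z'` to `z` inside `Y`; its domain is a down-set,
  -- so it also moves `y'`.
  have h1 : z ∈ q (t⁻¹ * s) z' :=
    hq.act_toGlob_toGlob.1 (hq.act_mul_iff.2 ⟨b, hq.act_symm hz', hb⟩)
  obtain ⟨y, hy⟩ := hq.exists_mem_of_le h1 hle
  refine ⟨y, ?_, hq.le_of_mem hy h1 hle⟩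
  obtain ⟨c, hc, hc'⟩ := hq.act_mul_iff.1 (hq.act_toGlob_toGlob.2 hy)
  rwa [← hq.act_inj hy' (hq.act_inv_iff.1 hc)] at hc'

instance : PartialOrder hq.Glob where
  le := hq.GlobLE
  le_refl a := by
    obtain ⟨t, y, h⟩ := hq.exists_act_eq_toGlob a
    exact ⟨t, y, y, h, h, le_rfl⟩
  le_trans a b c hab := by
    rintro ⟨t, y, z, hy, hz, hyz⟩
    obtain ⟨x, hx, hxy⟩ := hab.exists_act hq hy
    exact ⟨t, x, z, hx, hz, hxy.trans hyz⟩
  le_antisymm a b hab := by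
    rintro ⟨t, y, z, hy, hz, hyz⟩
    obtain ⟨x, hx, hxy⟩ := hab.exists_act hq hy
    have hxz := hq.toGlob_injective (hq.act_unique t a _ _ hx hz)
    subst hxz
    obtain rfl := le_antisymm hxy hyz
    exact hq.act_inj hz hy

theorem toGlob_le_toGlob {y z : Y} : hq.toGlob y ≤ hq.toGlob z ↔ y ≤ z := by
  constructor
  · intro h
    obtain ⟨e, he, hz⟩ := hq.exists_idem_mem z
    obtain ⟨x, hx, hxz⟩ := GlobLE.exists_act hq h (hq.act_toGlob_toGlob.2 hz)
    rwa [← hq.eq_of_idem he (hq.act_toGlob_toGlob.1 hx)]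
  · intro h
    obtain ⟨e, he, hz⟩ := hq.exists_idem_mem z
    exact ⟨e, y, z, hq.act_toGlob_toGlob.2 (hq.mem_idem_of_le he hz h),
      hq.act_toGlob_toGlob.2 hz, h⟩

theorem le_of_act {t : T} {a b a' b' : hq.Glob} (ha : hq.Act t a a') (hb : hq.Act t b b')
    (h : a ≤ b) : a' ≤ b' := by
  obtain ⟨s, y, z, hy, hz, hyz⟩ := h
  exact ⟨t⁻¹ * s, y, z, hq.act_mul_iff.2 ⟨a, hq.act_symm ha, hy⟩,
    hq.act_mul_iff.2 ⟨b, hq.act_symm hb, hz⟩, hyz⟩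

theorem exists_act_of_le {t : T} {a b b' : hq.Glob} (hb : hq.Act t b b') (h : a ≤ b) :
    ∃ a', hq.Act t a a' := by
  obtain ⟨s, y, z, hy, hz, hyz⟩ := h
  -- Seen from `z`, definedness of `t` at `b` says that an idempotent fixes `z`; it then fixes `y ≤
  -- z` too.
  have h1 := hq.exists_act_toGlob.1 ⟨_, hq.act_mul_iff.2 ⟨b, hq.act_symm hz, hb⟩⟩
  obtain ⟨a', ha'⟩ := hq.exists_act_toGlob.2 (hq.mem_idem_of_le (idem_mul_inv _) h1 hyz)
  obtain ⟨c, hc, hc'⟩ := hq.act_mul_iff.1 ha'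
  rw [← hq.act_inj hy (hq.act_inv_iff.1 hc)] at hc'
  exact ⟨a', hc'⟩

theorem isLowerSet_range_toGlob : IsLowerSet (Set.range hq.toGlob) := by
  rintro _ a h ⟨z, rfl⟩
  obtain ⟨e, he, hz⟩ := hq.exists_idem_mem z
  obtain ⟨y, hy, -⟩ := GlobLE.exists_act hq h (hq.act_toGlob_toGlob.2 hz)
  -- As `e e = e`, both `a` and the image of `y` are sent by `e` to the image of `y`; injectivity
  -- identifies them.
  obtain ⟨b, hb, hb'⟩ := hq.act_mul_iff.1 (he.symm ▸ hy : hq.Act (e * e) a (hq.toGlob y))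
  have := hq.act_unique e a _ _ hb hy
  subst this
  exact ⟨y, hq.act_inj hb' hb⟩

/-- The action on the globalization. -/
noncomputable def globAct (t : T) : hq.Glob →. hq.Glob := pfunOfRel (hq.Act t)

theorem mem_globAct {t : T} {a b : hq.Glob} : b ∈ hq.globAct t a ↔ hq.Act t a b :=
  mem_pfunOfRel (hq.act_unique t)

theorem isAction_globAct : IsAction hq.globAct where
  orderIso t a b a' b' ha hb := by
    rw [mem_globAct] at ha hb
    exact ⟨hq.le_of_act ha hb, hq.le_of_act (hq.act_symm ha) (hq.act_symm hb)⟩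
  act_mul s t := by
    refine PFun.ext fun a b => ?_
    rw [mem_globAct, act_mul_iff]
    refine Iff.trans ?_ Part.mem_bind_iff.symm
    simp only [mem_globAct]
  act_inv t a b := by
    rw [mem_globAct, mem_globAct, act_inv_iff]

theorem isLowerSet_dom_globAct (t : T) : IsLowerSet (hq.globAct t).Dom := by
  rintro b a h ⟨b', hb⟩
  exact hq.exists_act_of_le hb h

/-- The order embedding of a preaction into its globalization. -/
noncomputable def globEmbedding : Y ↪o hq.Glob :=
  OrderEmbedding.ofMapLEIff hq.toGlob fun _ _ => hq.toGlob_le_toGlob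

end IsPreaction

theorem IsPreaction.isActionExtending {T Y : Type u} [InverseSemigroup T] [PartialOrder Y]
    {q : T → Y →. Y} (hq : IsPreaction q) :
    IsActionExtending hq.globAct q hq.globEmbedding where
  isAction := hq.isAction_globAct
  range_lower := hq.isLowerSet_range_toGlob
  restrict t y z := hq.mem_globAct.trans hq.act_toGlob_toGlob
  le_iff a b := by
    constructor
    · rintro ⟨t, y, z, hy, hz, h⟩
      exact ⟨t, y, z, hq.mem_globAct.2 hy, hq.mem_globAct.2 hz, hq.toGlob_le_toGlob.2 h⟩
    · rintro ⟨t, y, z, hy, hz, h⟩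
      induction t using WithOne.recOneCoe with
      | one => rwa [← Part.mem_some_iff.1 hy, ← Part.mem_some_iff.1 hz]
      | coe t => exact ⟨t, y, z, hq.mem_globAct.1 hy, hq.mem_globAct.1 hz,
          hq.toGlob_le_toGlob.1 h⟩

/-! ### Computing in a `Q`-semigroup -/

namespace QTriple

variable {T : Type v} [InverseSemigroup T] {X : Type w} [PartialOrder X] (D : QTriple T X)

theorem act_functional {t : T} {x y z : X} (hy : y ∈ D.act t x) (hz : z ∈ D.act t x) : y = z :=
  Part.mem_unique hy hz

/-- Removes the choices in the multiplication: images and greatest lower bounds are unique. -/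
theorem pullMeet_eq (p : D.carrier) (b : D.Y) {x y z : X} (hx : x ∈ D.act p.1.2 p.1.1)
    (hy : IsGLB {x, (b : X)} y) (hz : z ∈ D.act p.1.2⁻¹ y) : (D.pullMeet p b : X) = z := by
  have h1 : (D.meet (D.app p) b : X) = y := by
    refine (D.meet_isGLB (D.app p) b).unique ?_
    rwa [D.act_functional (D.app_mem p) hx]
  have h2 : (D.pullMeet p b : X) ∈ D.act p.1.2⁻¹ (D.meet (D.app p) b : X) :=
    Part.get_mem (D.meet_app_mem_dom p b)
  rw [h1] at h2
  exact D.act_functional h2 hz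

end QTriple

/-! ### The `Q`-semigroup of an idempotent-pure congruence -/

namespace IsIdempotentPure

variable {S : Type u} [InverseSemigroup S] {c : Con S} (hc : IsIdempotentPure c)

theorem mem_conjPFun_self (hc : IsIdempotentPure c) {t : c.Quotient} (ht : IsIdempotentElem t) {e : Idem S} :
    e ∈ conjPFun c t e ↔ NatLE (e.val : c.Quotient) t := by
  rw [hc.mem_conjPFun']
  constructor
  · rintro ⟨s, hs, he, -⟩
    rw [← he]
    have := hs.mul_inv_self
    rwa [idem_mul_inv_eq ht] at this
  · intro h
    refine ⟨e.val, h, ?_, ?_⟩ <;> rw [idem_inv_eq e.isIdem, e.isIdem]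

theorem mem_dom_inter_range {t : c.Quotient} {x : hc.isPreaction.Glob} :
    x ∈ (hc.isPreaction.globAct t).Dom ∩ Set.range hc.isPreaction.toGlob ↔
      ∃ e : Idem S, NatLE (e.val : c.Quotient) (t * t⁻¹) ∧ hc.isPreaction.toGlob e = x := by
  constructor
  · rintro ⟨h, e, rfl⟩
    exact ⟨e, (hc.mem_conjPFun_self (idem_mul_inv t)).1
      (hc.isPreaction.exists_act_toGlob.1 h), rfl⟩
  · rintro ⟨e, h, rfl⟩
    exact ⟨hc.isPreaction.exists_act_toGlob.2 ((hc.mem_conjPFun_self (idem_mul_inv t)).2 h),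
      e, rfl⟩

theorem toGlob_mem_dom_inter_range {t : c.Quotient} {e : Idem S} :
    hc.isPreaction.toGlob e ∈
        (hc.isPreaction.globAct t).Dom ∩ Set.range hc.isPreaction.toGlob ↔
      NatLE (e.val : c.Quotient) (t * t⁻¹) := by
  rw [hc.mem_dom_inter_range]
  exact ⟨fun ⟨f, hf, h⟩ => hc.isPreaction.toGlob_injective h ▸ hf, fun h => ⟨e, h, rfl⟩⟩

/-- The class of `e` is the least `t t⁻¹` whose domain contains `e`, so the intersection is attained
there. This yields condition (2). -/
theorem delta_toGlob (e : Idem S) :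
    delta hc.isPreaction.globAct (Set.range hc.isPreaction.toGlob) (hc.isPreaction.toGlob e) =
      (hc.isPreaction.globAct (e.val : c.Quotient)).Dom ∩
        Set.range hc.isPreaction.toGlob := by
  have hee : (e.val : c.Quotient) * (e.val : c.Quotient)⁻¹ = (e.val : c.Quotient) :=
    idem_mul_inv_eq (isIdempotentElem_coe_quotient e.isIdem)
  apply Set.Subset.antisymm
  · have h := (hc.toGlob_mem_dom_inter_range (t := (e.val : c.Quotient)) (e := e)).2
      (by rw [hee]; exact NatLE.refl _)
    exact fun x hx => Set.mem_iInter₂.1 hx _ h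
  · intro x hx
    obtain ⟨f, hf, rfl⟩ := hc.mem_dom_inter_range.1 hx
    rw [hee] at hf
    refine Set.mem_iInter₂.2 fun t ht => ?_
    rw [hc.toGlob_mem_dom_inter_range]
    exact hf.trans (hc.toGlob_mem_dom_inter_range.1 ht)

theorem dom_eq_delta_iff {t : c.Quotient} {e : Idem S} :
    (hc.isPreaction.globAct t).Dom ∩ Set.range hc.isPreaction.toGlob =
      delta hc.isPreaction.globAct (Set.range hc.isPreaction.toGlob)
        (hc.isPreaction.toGlob e) ↔ t * t⁻¹ = (e.val : c.Quotient) := by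
  have he : IsIdempotentElem (e.val : c.Quotient) := isIdempotentElem_coe_quotient e.isIdem
  rw [hc.delta_toGlob]
  constructor
  · intro h
    have key : ∀ f : Idem S, NatLE (f.val : c.Quotient) (t * t⁻¹) ↔
        NatLE (f.val : c.Quotient) (e.val : c.Quotient) := by
      intro f
      rw [← hc.toGlob_mem_dom_inter_range, h, hc.toGlob_mem_dom_inter_range, idem_mul_inv_eq he]
    -- Since `t t⁻¹` is the class of an idempotent of `S`, points of `Y` suffice to compare it with
    -- `e/c`.
    obtain ⟨f, hf, hft⟩ := exists_idem_rep c _ (idem_mul_inv t)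
    refine NatLE.antisymm_of_idem (idem_mul_inv t) he ?_ ((key e).2 (NatLE.refl _))
    rw [← hft]
    exact (key ⟨f, hf⟩).1 (hft ▸ NatLE.refl _)
  · intro h
    ext x
    rw [hc.mem_dom_inter_range, hc.mem_dom_inter_range, h, idem_mul_inv_eq he]

theorem isGLB_toGlob (e f : Idem S) :
    IsGLB {hc.isPreaction.toGlob e, hc.isPreaction.toGlob f}
      (hc.isPreaction.toGlob (e ⊓ f)) := by
  constructor
  · rintro _ (rfl | rfl)
    · exact hc.isPreaction.toGlob_le_toGlob.2 inf_le_left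
    · exact hc.isPreaction.toGlob_le_toGlob.2 inf_le_right
  · intro x hx
    have h1 := hx (Set.mem_insert _ _)
    have h2 := hx (Set.mem_insert_of_mem _ rfl)
    -- Lower bounds in `X` already lie in the order ideal `Y`.
    obtain ⟨g, rfl⟩ := hc.isPreaction.isLowerSet_range_toGlob h1 ⟨e, rfl⟩
    rw [IsPreaction.toGlob_le_toGlob] at h1 h2 ⊢
    exact le_inf h1 h2

/-- The triple `(S/c, E(S), X)`, with `X` the globalization of the preaction of `S/c` on
`E(S)`. -/
noncomputable def qTriple : QTriple c.Quotient hc.isPreaction.Glob where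
  act := hc.isPreaction.globAct
  isAction := hc.isPreaction.isAction_globAct
  Y := Set.range hc.isPreaction.toGlob
  lower := hc.isPreaction.isLowerSet_range_toGlob
  exists_meet := by
    rintro _ ⟨e, rfl⟩ _ ⟨f, rfl⟩
    exact ⟨_, ⟨e ⊓ f, rfl⟩, hc.isGLB_toGlob e f⟩
  dom_lower := hc.isPreaction.isLowerSet_dom_globAct
  exists_dom := by
    rintro _ ⟨e, rfl⟩
    exact ⟨_, (hc.delta_toGlob e).symm⟩
  exists_mem x := by
    obtain ⟨t, y, h⟩ := hc.isPreaction.exists_act_eq_toGlob x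
    exact ⟨t, _, ⟨y, rfl⟩, hc.isPreaction.mem_globAct.2 h⟩

/-- The action of `s/c` sends `s s⁻¹` to `s⁻¹ s`. -/
theorem toGlob_mem_act (s : S) {e f : Idem S} (he : s * s⁻¹ = e.val) (hf : s⁻¹ * s = f.val) :
    hc.isPreaction.toGlob f ∈ hc.qTriple.act (s : c.Quotient) (hc.isPreaction.toGlob e) :=
  hc.isPreaction.mem_globAct.2 (hc.isPreaction.act_toGlob_toGlob.2
    (hc.mem_conjPFun'.2 ⟨s, NatLE.refl _, he, hf⟩))

/-- The element `(s s⁻¹, s/c)` of the `Q`-semigroup. -/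
noncomputable def toCarrier (s : S) : hc.qTriple.carrier :=
  ⟨(⟨hc.isPreaction.toGlob (rangeIdem s), _, rfl⟩, (s : c.Quotient)),
    hc.dom_eq_delta_iff.2 rfl, _, ⟨rangeIdem s⁻¹, rfl⟩,
    hc.toGlob_mem_act s rfl (congrArg (s⁻¹ * ·) (inv_inv_eq s).symm)⟩

theorem toCarrier_injective : Function.Injective hc.toCarrier := by
  intro s t h
  have h1 : hc.isPreaction.toGlob (rangeIdem s) = hc.isPreaction.toGlob (rangeIdem t) :=
    congrArg (fun p => (p.1.1 : hc.isPreaction.Glob)) h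
  have h2 : (s : c.Quotient) = t := congrArg (fun p => p.1.2) h
  exact hc.eq_of_rel ((Con.eq c).1 h2)
    (congrArg Idem.val (hc.isPreaction.toGlob_injective h1))

/-- That `(e)t` lies in `Y` gives `s` with `s s⁻¹ = e` and `s/c ≤ t`; the domain condition `t t⁻¹ =
e/c` makes this an equality. -/
theorem toCarrier_surjective : Function.Surjective hc.toCarrier := by
  rintro ⟨⟨⟨_, e, rfl⟩, t⟩, hdom, _, ⟨f, rfl⟩, hf⟩
  have hdom' : t * t⁻¹ = (e.val : c.Quotient) := hc.dom_eq_delta_iff.1 hdom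
  obtain ⟨s, hs, hse, -⟩ := hc.mem_conjPFun'.1
    (hc.isPreaction.act_toGlob_toGlob.1 (hc.isPreaction.mem_globAct.1 hf))
  have hst : (s : c.Quotient) = t := by
    have h1 : (s : c.Quotient) * (s : c.Quotient)⁻¹ = (e.val : c.Quotient) :=
      congrArg (fun z : S => (z : c.Quotient)) hse
    rw [hs.eq, h1, ← hdom', mul_inv_mul]
  have hes : rangeIdem s = e := Idem.ext hse
  subst hst hes
  exact ⟨s, rfl⟩

/-- The class of `s` moves `s s⁻¹` to `s⁻¹ s`; pulling the meet with `t t⁻¹` back gives `s (s⁻¹ s t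
t⁻¹) s⁻¹ = (s t)(s t)⁻¹`. -/
theorem mul_toCarrier (s t : S) :
    hc.qTriple.mul (hc.toCarrier s) (hc.toCarrier t) = (hc.toCarrier (s * t)).1 := by
  refine Prod.ext (Subtype.ext ?_) rfl
  refine hc.qTriple.pullMeet_eq (hc.toCarrier s) _
    (hc.toGlob_mem_act s rfl (f := rangeIdem s⁻¹) (congrArg (s⁻¹ * ·) (inv_inv_eq s).symm))
    (hc.isGLB_toGlob (rangeIdem s⁻¹) (rangeIdem t)) ?_
  refine hc.isPreaction.mem_globAct.2 (hc.isPreaction.act_toGlob_toGlob.2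
    (hc.mem_conjPFun.2 ⟨s⁻¹, NatLE.refl _, inf_le_left, Idem.ext ?_⟩))
  change s * t * (s * t)⁻¹ = s⁻¹⁻¹ * (s⁻¹ * s⁻¹⁻¹ * (t * t⁻¹)) * s⁻¹
  rw [inv_inv_eq, mul_inv_rev_eq]
  calc s * t * (t⁻¹ * s⁻¹) = s * s⁻¹ * s * (t * t⁻¹) * s⁻¹ := by
        rw [mul_inv_mul]; simp only [mul_assoc]
    _ = s * (s⁻¹ * s * (t * t⁻¹)) * s⁻¹ := by simp only [mul_assoc]

theorem mulClosed : hc.qTriple.MulClosed := by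
  intro p r
  obtain ⟨s, rfl⟩ := hc.toCarrier_surjective p
  obtain ⟨t, rfl⟩ := hc.toCarrier_surjective r
  rw [hc.mul_toCarrier]
  exact (hc.toCarrier (s * t)).2

/-- The isomorphism `s ↦ (s s⁻¹, s/c)` of `S` with the `Q`-semigroup. -/
noncomputable def mulEquivQ : S ≃* hc.qTriple.Q hc.mulClosed where
  toEquiv := Equiv.ofBijective hc.toCarrier ⟨hc.toCarrier_injective, hc.toCarrier_surjective⟩
  map_mul' s t := Subtype.ext (hc.mul_toCarrier s t).symm

end IsIdempotentPure

end InverseSemigroup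

/-! ### The case of the syntactic congruence. -/

theorem mainTheorem1 (S : Type u) [InverseSemigroup S] :
    IsGreatest {c : Con S | InverseSemigroup.IsIdempotentPure c}
        (InverseSemigroup.syntacticCon S) ∧
    InverseSemigroup.IsEDisjunctive (InverseSemigroup.SynQuotient S) ∧
    ∃ (q : InverseSemigroup.SynQuotient S →
          InverseSemigroup.Idem S →. InverseSemigroup.Idem S)
      (X : Type u) (_ : PartialOrder X)
      (D : InverseSemigroup.QTriple (InverseSemigroup.SynQuotient S) X)
      (ι : InverseSemigroup.Idem S ↪o X)
      (hQ : D.MulClosed) (φ : S ≃* D.Q hQ),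
      (∀ (t : InverseSemigroup.SynQuotient S) (e f : InverseSemigroup.Idem S),
        f ∈ q t e ↔ ∃ s : S,
          InverseSemigroup.NatLE (s : InverseSemigroup.SynQuotient S) t ∧
          e ≤ InverseSemigroup.rangeIdem s ∧ f = InverseSemigroup.conjIdem e s) ∧
      InverseSemigroup.IsPreaction q ∧
      InverseSemigroup.IsActionExtending D.act q ι ∧
      D.Y = Set.range ι ∧
      ∀ s : S, ((φ s).1.1 : X) = ι (InverseSemigroup.rangeIdem s) ∧
        (φ s).1.2 = (s : InverseSemigroup.SynQuotient S) := by
  have hc := InverseSemigroup.isIdempotentPure_syntacticCon (S := S)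
  exact ⟨InverseSemigroup.isGreatest_syntacticCon,
    InverseSemigroup.isEDisjunctive_synQuotient,
    InverseSemigroup.conjPFun _, hc.isPreaction.Glob, inferInstance, hc.qTriple,
    hc.isPreaction.globEmbedding, hc.mulClosed, hc.mulEquivQ,
    fun _ _ _ => hc.mem_conjPFun, hc.isPreaction, hc.isPreaction.isActionExtending, rfl,
    fun _ => ⟨rfl, rfl⟩⟩
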